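/- Let $X$ be a noncompact proper $\mathrm{CAT}(0)$ space (proper means that all closed balls are compact), and let a group $\Gamma$ act on $X$ by isometries and cocompactly, i.e. there is a compact set $C\subseteq X$ with $X=\bigcup_{\gamma\in\Gamma}\gamma C$. Let $H^i_c(X)$ denote the cohomology of $X$ with integer coefficients and compact supports. If $H^i_c(X)\neq 0$ for some $i$, then $X$ is almost geodesically complete: there is a constant $C'$ such that for all $p,q\in X$ there is a geodesic ray $\alpha:[0,\infty)\to X$ with $\alpha(0)=p$ and $d(q,\alpha([0,\infty)))\leq C'$. -/

import Mathlib

/-! ### Geodesics, `CAT(0)` spaces, almost geodesic completeness -/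

/-- `c` restricts to a geodesic segment from `x` to `y`: an isometric embedding of the interval
`[0, dist x y]` taking the endpoints to `x` and `y`. (Values outside the interval play no role.) -/
structure IsGeodesicSegment {X : Type*} [MetricSpace X] (x y : X) (c : ℝ → X) : Prop where
  source : c 0 = x
  target : c (dist x y) = y
  isometry : ∀ s ∈ Set.Icc 0 (dist x y), ∀ t ∈ Set.Icc 0 (dist x y), dist (c s) (c t) = |s - t|

/-- `α` restricts to a geodesic ray: an isometric embedding of `[0, ∞)`. -/
def IsGeodesicRay {X : Type*} [MetricSpace X] (α : ℝ → X) : Prop :=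
  ∀ s ∈ Set.Ici (0 : ℝ), ∀ t ∈ Set.Ici (0 : ℝ), dist (α s) (α t) = |s - t|

/-- A geodesic space: any two points are joined by a geodesic segment. -/
def IsGeodesicSpace (X : Type*) [MetricSpace X] : Prop :=
  ∀ x y : X, ∃ c : ℝ → X, IsGeodesicSegment x y c

/-- A `CAT(0)` space: a geodesic space in which geodesic triangles are no thicker than their
comparison triangles in the Euclidean plane. Any two sides of a triangle share a vertex, here
called `p`; the points compared are `c s` on the side `[p, q]` and `c' t` on the side `[p, r]`.
The triangle `p' q' r'` is a comparison triangle, and `x'`, `y'` are the comparison points.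
(Two points on the same side always have the same distance as their comparison points.) -/
structure IsCAT0 (X : Type*) [MetricSpace X] : Prop where
  geodesic : IsGeodesicSpace X
  comparison : ∀ (p q r : X) (c c' : ℝ → X),
    IsGeodesicSegment p q c → IsGeodesicSegment p r c' →
    ∀ p' q' r' : EuclideanSpace ℝ (Fin 2),
      dist p' q' = dist p q → dist p' r' = dist p r → dist q' r' = dist q r →
      ∀ s ∈ Set.Icc 0 (dist p q), ∀ t ∈ Set.Icc 0 (dist p r),
      ∀ x' ∈ segment ℝ p' q', ∀ y' ∈ segment ℝ p' r',
        dist p' x' = s → dist p' y' = t → dist (c s) (c' t) ≤ dist x' y'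

/-- A geodesic space is almost geodesically complete if there is a constant `C` such that for all
points `p`, `q` some geodesic ray issuing from `p` passes within distance `C` of `q`. -/
def IsAlmostGeodesicallyComplete (X : Type*) [MetricSpace X] : Prop :=
  IsGeodesicSpace X ∧
    ∃ C : ℝ, ∀ p q : X, ∃ α : ℝ → X,
      IsGeodesicRay α ∧ α 0 = p ∧ Metric.infDist q (α '' Set.Ici 0) ≤ C

/-- The action of `Γ` on `X` is cocompact: the translates of some compact set cover `X`. -/
def IsCocompactAction (Γ X : Type*) [Group Γ] [TopologicalSpace X] [MulAction Γ X] : Prop :=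
  ∃ C : Set X, IsCompact C ∧ ⋃ γ : Γ, (fun x : X => γ • x) '' C = Set.univ

/-! ### Integral (singular) cohomology with compact supports -/

/-- Singular `n`-simplices of `X`. -/
abbrev SingularSimplex (X : Type*) [TopologicalSpace X] (n : ℕ) : Type _ :=
  C(stdSimplex ℝ (Fin (n + 1)), X)

/-- The `i`-th face of a singular simplex. -/
noncomputable def SingularSimplex.face {X : Type*} [TopologicalSpace X] {n : ℕ}
    (σ : SingularSimplex X (n + 1)) (i : Fin (n + 2)) : SingularSimplex X n :=
  σ.comp ⟨stdSimplex.map (Fin.succAbove i), stdSimplex.continuous_map _⟩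

/-- Compactly supported integral singular `n`-cochains: those which, for some compact `K ⊆ X`,
vanish on all singular simplices in `X \ K`. -/
def compactCochains (X : Type*) [TopologicalSpace X] (n : ℕ) :
    AddSubgroup (SingularSimplex X n → ℤ) where
  carrier := {φ | ∃ K : Set X, IsCompact K ∧
    ∀ σ : SingularSimplex X n, Disjoint (Set.range σ) K → φ σ = 0}
  zero_mem' := ⟨∅, isCompact_empty, fun _ _ => rfl⟩
  add_mem' := by
    rintro φ ψ ⟨K, hK, hφ⟩ ⟨L, hL, hψ⟩
    refine ⟨K ∪ L, hK.union hL, fun σ hσ => ?_⟩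
    rw [Set.disjoint_union_right] at hσ
    simp [hφ σ hσ.1, hψ σ hσ.2]
  neg_mem' := by
    rintro φ ⟨K, hK, hφ⟩
    exact ⟨K, hK, fun σ hσ => by simp [hφ σ hσ]⟩

/-- The singular coboundary `(δ φ)(σ) = ∑ i, (-1)^i φ(i-th face of σ)` on compactly supported
cochains. -/
noncomputable def compactCoboundary (X : Type*) [TopologicalSpace X] (n : ℕ) :
    compactCochains X n →+ compactCochains X (n + 1) where
  toFun φ := ⟨fun σ => ∑ i : Fin (n + 2), (-1) ^ (i : ℕ) * φ.1 (σ.face i), by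
    obtain ⟨φ, K, hK, hφ⟩ := φ
    refine ⟨K, hK, fun σ hσ => Finset.sum_eq_zero fun i _ => ?_⟩
    have h : Disjoint (Set.range (σ.face i)) K :=
      hσ.mono_left (Set.range_comp_subset_range _ σ)
    simp [hφ _ h]⟩
  map_zero' := by
    ext σ
    simp
  map_add' φ ψ := by
    ext σ
    simp [mul_add, Finset.sum_add_distrib]

theorem SingularSimplex.face_face {X : Type*} [TopologicalSpace X] {n : ℕ}
    (σ : SingularSimplex X (n + 2)) {i j : Fin (n + 2)} (h : i ≤ j) :
    (σ.face j.succ).face i = (σ.face i.castSucc).face j := by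
  ext x
  simp only [SingularSimplex.face, ContinuousMap.comp_apply, ContinuousMap.coe_mk,
    stdSimplex.map_comp_apply]
  congr 2
  funext k
  simp only [Function.comp_apply]
  ext
  simp only [Fin.succAbove, Fin.lt_def, Fin.le_def] at *
  grind

/-- The compactly supported singular cochains form a cochain complex. -/
theorem compactCoboundary_comp (X : Type*) [TopologicalSpace X] (n : ℕ)
    (φ : compactCochains X n) :
    compactCoboundary X (n + 1) (compactCoboundary X n φ) = 0 := by
  ext σ
  let f : Fin (n + 3) × Fin (n + 2) → ℤ := fun p =>
    (-1) ^ (p.1 : ℕ) * ((-1) ^ (p.2 : ℕ) * φ.1 ((σ.face p.1).face p.2))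
  have key : ∀ i j : Fin (n + 2), i ≤ j → f (j.succ, i) + f (i.castSucc, j) = 0 := by
    intro i j h
    simp only [f, SingularSimplex.face_face σ h, Fin.val_succ, Fin.val_castSucc]
    ring
  have hlast : ∀ p : Fin (n + 3) × Fin (n + 2), ¬ p.2.castSucc < p.1 → p.1 ≠ Fin.last _ := by
    rintro ⟨j, i⟩ h rfl
    exact h (Fin.castSucc_lt_last i)
  have hsum : ∑ p, f p = 0 := by
    refine Finset.sum_involution
      (fun p _ => if h : p.2.castSucc < p.1 then (p.2.castSucc, p.1.pred (Fin.ne_zero_of_lt h))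
        else (p.2.succ, p.1.castPred (hlast p h)))
      ?_ ?_ (fun _ _ => Finset.mem_univ _) ?_
    · rintro ⟨j, i⟩ -
      dsimp only
      split_ifs with h
      · obtain ⟨k, rfl⟩ := Fin.eq_succ_of_ne_zero (Fin.ne_zero_of_lt h)
        rw [Fin.pred_succ]
        exact key i k (Fin.castSucc_lt_succ_iff.mp h)
      · obtain ⟨k, rfl⟩ : ∃ k : Fin (n + 2), k.castSucc = j :=
          ⟨j.castPred (hlast (j, i) h), Fin.castSucc_castPred _ _⟩
        rw [Fin.castPred_castSucc, add_comm]
        exact key k i (Fin.castSucc_le_castSucc_iff.mp (not_lt.mp h))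
    · rintro ⟨j, i⟩ - -
      dsimp only
      split_ifs with h <;> simp only [ne_eq, Prod.mk.injEq, Fin.ext_iff, Fin.lt_def] at * <;>
        simp at * <;> omega
    · rintro ⟨j, i⟩ -
      by_cases h : i.castSucc < j
      · have h' : ¬ (j.pred (Fin.ne_zero_of_lt h)).castSucc < i.castSucc := by
          simp only [Fin.lt_def, Fin.val_castSucc, Fin.val_pred] at h ⊢
          omega
        simp [h, h']
      · have h' : j < i.succ := by
          simp only [Fin.lt_def, Fin.val_castSucc, Fin.val_succ] at h ⊢
          omega
        simp [h, h']
  rw [Fintype.sum_prod_type] at hsum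
  simpa [compactCoboundary, f, Finset.mul_sum] using hsum

/-- Compactly supported `n`-cocycles. -/
noncomputable def compactCocycles (X : Type*) [TopologicalSpace X] (n : ℕ) :
    AddSubgroup (compactCochains X n) :=
  (compactCoboundary X n).ker

/-- Coboundaries of compactly supported cochains. -/
noncomputable def compactCoboundaries (X : Type*) [TopologicalSpace X] :
    (n : ℕ) → AddSubgroup (compactCochains X n)
  | 0 => ⊥
  | n + 1 => (compactCoboundary X n).range

theorem compactCoboundaries_le_cocycles (X : Type*) [TopologicalSpace X] (n : ℕ) :
    compactCoboundaries X n ≤ compactCocycles X n := by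
  cases n with
  | zero => exact bot_le
  | succ n =>
    rintro _ ⟨φ, rfl⟩
    exact compactCoboundary_comp X n φ

/-- `H^n_c(X)`: singular cohomology of `X` with compact supports and integer coefficients,
cocycles modulo coboundaries. -/
abbrev CompactCohomology (X : Type*) [TopologicalSpace X] (n : ℕ) : Type _ :=
  compactCocycles X n ⧸ (compactCoboundaries X n).addSubgroupOf (compactCocycles X n)

/-! Fix a cocycle `φ` that is not the coboundary of a compactly supported cochain, and a compact `K`
off which `φ` vanishes. Geodesics contract `X` to any point `p`, continuously because of the
`CAT(0)` inequality (`IsCAT0.dist_contract_le`). Suppose that, for some `R`, no geodesic from `p` to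
a point outside the ball of radius `R` met `K`. Coning simplices off to `p` would then turn
simplices outside the ball into simplices missing `K`, so `φ ∘ cone` would be compactly supported
with coboundary `φ`, a contradiction (`mem_compactCoboundaries_of_contraction`). Hence from every
`p` arbitrarily long segments meet `K`, and by properness they have a limit ray meeting `K`
(`exists_geodesicRay_of_segments`). As `K` is independent of `p`, cocompactness lets a translate of
`K` come uniformly close to any `q`. -/

/-! ### Comparison triangles and geodesic contraction -/

/-- Every triangle in a metric space has a comparison triangle in the Euclidean plane. -/
theorem exists_comparison_triangle {X : Type*} [MetricSpace X] (p q r : X) :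
    ∃ p' q' r' : EuclideanSpace ℝ (Fin 2),
      dist p' q' = dist p q ∧ dist p' r' = dist p r ∧ dist q' r' = dist q r := by
  rcases (dist_nonneg (x := p) (y := q)).eq_or_lt with h0 | h0
  · obtain rfl : p = q := dist_eq_zero.1 h0.symm
    refine ⟨0, 0, !₂[dist p r, 0], ?_, ?_, ?_⟩ <;>
      simp [EuclideanSpace.dist_eq, Real.dist_eq]
  · have h1 := dist_triangle p q r
    have h2 := dist_triangle p r q
    have h3 := dist_triangle q p r
    rw [dist_comm r q] at h2
    rw [dist_comm q p] at h3
    set a := dist p q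
    set b := dist p r
    set c := dist q r
    have hb : 0 ≤ b := dist_nonneg
    have hc : 0 ≤ c := dist_nonneg
    -- By the law of cosines, the first coordinate of `r'` when `p'` is the origin and `q' = (a,
    -- 0)`.
    set x := (a ^ 2 + b ^ 2 - c ^ 2) / (2 * a) with hx
    have hxa : 2 * a * x = a ^ 2 + b ^ 2 - c ^ 2 := by rw [hx]; field_simp
    have hxb : x ≤ b := by
      rw [hx, div_le_iff₀ (by positivity)]
      nlinarith
    have hxb' : -b ≤ x := by
      rw [hx, le_div_iff₀ (by positivity)]
      nlinarith
    have hy : 0 ≤ b ^ 2 - x ^ 2 := by nlinarith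
    have hy' := Real.sq_sqrt hy
    refine ⟨0, !₂[a, 0], !₂[x, √(b ^ 2 - x ^ 2)], ?_, ?_, ?_⟩
    · simp [EuclideanSpace.dist_eq, Real.dist_eq, h0.le]
    · rw [EuclideanSpace.dist_eq, Real.sqrt_eq_iff_eq_sq (by positivity) hb]
      simp [Real.dist_eq, sq_abs, hy']
    · rw [EuclideanSpace.dist_eq, Real.sqrt_eq_iff_eq_sq (by positivity) hc]
      simp only [Fin.sum_univ_two, Real.dist_eq, sq_abs]
      simp [hy']
      linarith

/-- In a `CAT(0)` space, contracting along geodesics towards `p` is Lipschitz. -/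
theorem IsCAT0.dist_contract_le {X : Type*} [MetricSpace X] (hX : IsCAT0 X) {p q r : X}
    {c c' : ℝ → X} (hc : IsGeodesicSegment p q c) (hc' : IsGeodesicSegment p r c')
    {t : ℝ} (ht : t ∈ Set.Icc (0 : ℝ) 1) :
    dist (c (t * dist p q)) (c' (t * dist p r)) ≤ t * dist q r := by
  obtain ⟨p', q', r', hpq, hpr, hqr⟩ := exists_comparison_triangle p q r
  have key : ∀ a : ℝ, 0 ≤ a → t * a ∈ Set.Icc 0 a := fun a ha =>
    ⟨mul_nonneg ht.1 ha, mul_le_of_le_one_left ha ht.2⟩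
  refine (hX.comparison p q r c c' hc hc' p' q' r' hpq hpr hqr _ (key _ dist_nonneg) _
    (key _ dist_nonneg) (AffineMap.lineMap p' q' t) ?_ (AffineMap.lineMap p' r' t) ?_ ?_ ?_).trans
    (le_of_eq ?_)
  · rw [segment_eq_image_lineMap]; exact ⟨t, ht, rfl⟩
  · rw [segment_eq_image_lineMap]; exact ⟨t, ht, rfl⟩
  · rw [dist_left_lineMap, Real.norm_of_nonneg ht.1, hpq]
  · rw [dist_left_lineMap, Real.norm_of_nonneg ht.1, hpr]
  · rw [AffineMap.lineMap_apply_module, AffineMap.lineMap_apply_module, dist_add_left,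
      dist_smul₀, Real.norm_of_nonneg ht.1, hqr]

/-- A `CAT(0)` space contracts continuously, along geodesics, to any of its points. -/
theorem IsCAT0.exists_geodesic_contraction {X : Type*} [MetricSpace X] (hX : IsCAT0 X) (p : X) :
    ∃ (c : X → ℝ → X) (H : C(unitInterval × X, X)), (∀ x, IsGeodesicSegment p x (c x)) ∧
      ∀ t x, H (t, x) = c x (t * dist p x) := by
  choose c hc using hX.geodesic p
  refine ⟨c, ⟨fun z => c z.2 (z.1 * dist p z.2), ?_⟩, hc, fun _ _ => rfl⟩
  have hmem : ∀ (t : unitInterval) (x : X), (t : ℝ) * dist p x ∈ Set.Icc 0 (dist p x) :=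
    fun t x => ⟨mul_nonneg t.2.1 dist_nonneg, mul_le_of_le_one_left dist_nonneg t.2.2⟩
  -- Move the endpoint at a fixed ratio, then the ratio along a fixed geodesic.
  have hb : ∀ z w : unitInterval × X,
      dist (c z.2 (z.1 * dist p z.2)) (c w.2 (w.1 * dist p w.2)) ≤
        dist z.2 w.2 + |(z.1 : ℝ) * dist p w.2 - w.1 * dist p w.2| := fun z w =>
    (dist_triangle _ (c w.2 (z.1 * dist p w.2)) _).trans <| add_le_add
      ((hX.dist_contract_le (hc _) (hc _) z.1.2).trans
        (mul_le_of_le_one_left dist_nonneg z.1.2.2))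
      ((hc w.2).isometry _ (hmem _ _) _ (hmem _ _)).le
  rw [continuous_iff_continuousAt]
  intro w
  rw [ContinuousAt, tendsto_iff_dist_tendsto_zero]
  refine squeeze_zero (fun _ => dist_nonneg) (fun z => hb z w) ?_
  have hcont : Continuous fun z : unitInterval × X =>
      dist z.2 w.2 + |(z.1 : ℝ) * dist p w.2 - w.1 * dist p w.2| := by fun_prop
  simpa using hcont.tendsto w

/-! ### Cones on singular simplices -/

/-- Join coordinates: the point dividing the segment from the initial vertex of the
`(n + 1)`-simplex to a point of the opposite face in the ratio `s : 1 - s`. -/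
noncomputable def stdSimplexCone (n : ℕ) :
    C(stdSimplex ℝ (Fin (n + 1)) × unitInterval, stdSimplex ℝ (Fin (n + 2))) where
  toFun z := ⟨Fin.cons (1 - (z.2 : ℝ)) fun i => (z.2 : ℝ) * z.1 i, by
    refine ⟨fun i => ?_, ?_⟩
    · refine Fin.cases ?_ (fun j => ?_) i
      · simpa using z.2.2.2
      · exact mul_nonneg z.2.2.1 (z.1.2.1 j)
    · rw [Fin.sum_univ_succ]
      simp [← Finset.mul_sum]⟩
  continuous_toFun := by
    refine Continuous.subtype_mk (continuous_pi fun i => ?_) _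
    refine Fin.cases ?_ (fun j => ?_) i
    · simp only [Fin.cons_zero]
      fun_prop
    · simp only [Fin.cons_succ]
      exact (continuous_subtype_val.comp continuous_snd).mul
        ((continuous_apply j).comp (continuous_subtype_val.comp continuous_fst))

theorem stdSimplexCone_zero {n : ℕ} (u : stdSimplex ℝ (Fin (n + 1))) (s : unitInterval) :
    stdSimplexCone n (u, s) 0 = 1 - (s : ℝ) := rfl

theorem stdSimplexCone_succ {n : ℕ} (u : stdSimplex ℝ (Fin (n + 1))) (s : unitInterval)
    (i : Fin (n + 1)) : stdSimplexCone n (u, s) i.succ = (s : ℝ) * u i := rfl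

theorem stdSimplexCone_surjective (n : ℕ) : Function.Surjective (stdSimplexCone n) := by
  intro t
  have hsum : t 0 + ∑ i : Fin (n + 1), t i.succ = 1 := by
    rw [← Fin.sum_univ_succ]; exact stdSimplex.sum_eq_one t
  have hle := stdSimplex.le_one t 0
  by_cases h : t 0 = 1
  · refine ⟨(Classical.arbitrary _, 0), stdSimplex.ext (funext fun i => ?_)⟩
    have hz : ∑ i : Fin (n + 1), t i.succ = 0 := by linarith
    rw [Finset.sum_eq_zero_iff_of_nonneg fun i _ => stdSimplex.zero_le t _] at hz
    refine Fin.cases ?_ (fun j => ?_) i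
    · simp [stdSimplexCone_zero, h]
    · simp [stdSimplexCone_succ, hz j (Finset.mem_univ _)]
  · have hpos : 0 < 1 - t 0 := by
      have := lt_of_le_of_ne hle h
      linarith
    refine ⟨(⟨fun i => t i.succ / (1 - t 0), fun i => div_nonneg (stdSimplex.zero_le t _) hpos.le, ?_⟩,
      ⟨1 - t 0, hpos.le, sub_le_self _ (stdSimplex.zero_le t 0)⟩), stdSimplex.ext (funext fun i => ?_)⟩
    · rw [← Finset.sum_div, div_eq_one_iff_eq hpos.ne']
      linarith
    · refine Fin.cases ?_ (fun j => ?_) i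
      · simp [stdSimplexCone_zero]
      · rw [stdSimplexCone_succ]
        exact mul_div_cancel₀ _ hpos.ne'

/-- A continuous surjection from a compact space to a Hausdorff one is a quotient map. This makes
cones, defined in join coordinates, continuous on the simplex. -/
theorem isQuotientMap_stdSimplexCone (n : ℕ) : Topology.IsQuotientMap (stdSimplexCone n) :=
  (stdSimplexCone n).continuous.isClosedMap.isQuotientMap (stdSimplexCone n).continuous
    (stdSimplexCone_surjective n)

theorem stdSimplex.map_apply_of_injective {m n : ℕ} {f : Fin m → Fin n}
    (hf : Function.Injective f) (u : stdSimplex ℝ (Fin m)) (i : Fin m) :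
    stdSimplex.map f u (f i) = u i := by
  rw [stdSimplex.map_coe, FunOnFinite.linearMap_apply_apply]
  simp [hf.eq_iff, Finset.sum_filter]

theorem stdSimplex.map_apply_of_notMem_range {m n : ℕ} {f : Fin m → Fin n}
    (u : stdSimplex ℝ (Fin m)) {j : Fin n} (hj : ∀ i, f i ≠ j) :
    stdSimplex.map f u j = 0 := by
  rw [stdSimplex.map_coe, FunOnFinite.linearMap_apply_apply]
  simp [hj]

theorem stdSimplexCone_one {n : ℕ} (u : stdSimplex ℝ (Fin (n + 1))) :
    stdSimplexCone n (u, 1) = stdSimplex.map (Fin.succAbove 0) u := by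
  refine stdSimplex.ext (funext fun i => ?_)
  refine Fin.cases ?_ (fun j => ?_) i
  · rw [stdSimplexCone_zero, stdSimplex.map_apply_of_notMem_range u fun i => by simp]
    simp
  · rw [stdSimplexCone_succ, ← Fin.succAbove_zero_apply,
      stdSimplex.map_apply_of_injective Fin.succAbove_right_injective]
    simp

/-- Needed to see that every face of a cone other than its base is the cone on a face. -/
theorem map_succAbove_stdSimplexCone {n : ℕ} (i : Fin (n + 2)) (u : stdSimplex ℝ (Fin (n + 1)))
    (s : unitInterval) :
    stdSimplex.map (Fin.succAbove i.succ) (stdSimplexCone n (u, s)) =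
      stdSimplexCone (n + 1) (stdSimplex.map (Fin.succAbove i) u, s) := by
  refine stdSimplex.ext (funext fun j => ?_)
  refine Fin.cases ?_ (fun j => ?_) j
  · rw [stdSimplexCone_zero, ← Fin.succ_succAbove_zero i,
      stdSimplex.map_apply_of_injective Fin.succAbove_right_injective, stdSimplexCone_zero]
  · rw [stdSimplexCone_succ]
    by_cases h : ∃ k, i.succAbove k = j
    · obtain ⟨k, rfl⟩ := h
      rw [← Fin.succ_succAbove_succ,
        stdSimplex.map_apply_of_injective Fin.succAbove_right_injective,
        stdSimplex.map_apply_of_injective Fin.succAbove_right_injective, stdSimplexCone_succ]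
    · push Not at h
      rw [stdSimplex.map_apply_of_notMem_range u h, stdSimplex.map_apply_of_notMem_range, mul_zero]
      intro k
      refine Fin.cases ?_ (fun k => ?_) k
      · rw [Fin.succ_succAbove_zero]
        exact (Fin.succ_ne_zero j).symm
      · rw [Fin.succ_succAbove_succ]
        exact fun hk => h k (Fin.succ_injective _ hk)

/-- A contraction `H` of `X` to `p` turns each singular simplex into a cone with apex `p`. -/
theorem exists_singular_cone {X : Type*} [TopologicalSpace X] {p : X} (H : C(unitInterval × X, X))
    (hp : ∀ x, H (0, x) = p) {n : ℕ} (σ : SingularSimplex X n) :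
    ∃ τ : SingularSimplex X (n + 1), ∀ u s, τ (stdSimplexCone n (u, s)) = H (s, σ u) := by
  let g : C(stdSimplex ℝ (Fin (n + 1)) × unitInterval, X) :=
    ⟨fun z => H (z.2, σ z.1), by fun_prop⟩
  have hg : Function.FactorsThrough g (stdSimplexCone n) := by
    rintro ⟨u, s⟩ ⟨v, t⟩ h
    have h' : ∀ i, stdSimplexCone n (u, s) i = stdSimplexCone n (v, t) i := fun i => by rw [h]
    obtain rfl : s = t := by
      have := h' 0
      rw [stdSimplexCone_zero, stdSimplexCone_zero] at this
      exact Subtype.ext (by linarith)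
    -- Join coordinates are ambiguous only at the apex `s = 0`, where `H` is constantly `p`.
    by_cases hs : s = 0
    · simp [g, hs, hp]
    · obtain rfl : u = v := stdSimplex.ext <| funext fun i => by
        have := h' i.succ
        rw [stdSimplexCone_succ, stdSimplexCone_succ] at this
        exact mul_left_cancel₀ (fun h => hs (Subtype.ext h)) this
      rfl
  refine ⟨(isQuotientMap_stdSimplexCone n).lift g hg, fun u s => ?_⟩
  exact congr($((isQuotientMap_stdSimplexCone n).lift_comp g hg) (u, s))

/-! ### Vanishing of classes by coning -/

/-- Suppose that `X` contracts to a point through a homotopy under which the complement of a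
compact set never meets `K`. Then every cocycle supported in `K` is the coboundary of a compactly
supported cochain. -/
theorem mem_compactCoboundaries_of_contraction {X : Type*} [TopologicalSpace X] {p : X}
    (H : C(unitInterval × X, X)) (h0 : ∀ x, H (0, x) = p) (h1 : ∀ x, H (1, x) = x)
    {K L : Set X} (hL : IsCompact L) (hLX : ∃ x, x ∉ L) (hLK : ∀ x ∉ L, ∀ t, H (t, x) ∉ K) {n : ℕ}
    {φ : compactCochains X n} (hφ : φ ∈ compactCocycles X n)
    (hφK : ∀ σ : SingularSimplex X n, Disjoint (Set.range σ) K → φ.1 σ = 0) :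
    φ ∈ compactCoboundaries X n := by
  choose cone hcone using fun (n : ℕ) (σ : SingularSimplex X n) => exists_singular_cone H h0 σ
  have face_zero : ∀ (n : ℕ) (σ : SingularSimplex X n), (cone n σ).face 0 = σ := fun n σ =>
    ContinuousMap.ext fun u => by
      change cone n σ (stdSimplex.map (Fin.succAbove 0) u) = σ u
      rw [← stdSimplexCone_one, hcone, h1]
  have face_succ : ∀ (n : ℕ) (σ : SingularSimplex X (n + 1)) (i : Fin (n + 2)),
      (cone (n + 1) σ).face i.succ = cone n (σ.face i) := fun n σ i =>
    ContinuousMap.ext fun w => by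
      obtain ⟨⟨u, s⟩, rfl⟩ := stdSimplexCone_surjective n w
      change cone (n + 1) σ (stdSimplex.map (Fin.succAbove i.succ) _) = _
      rw [map_succAbove_stdSimplexCone, hcone, hcone]
      rfl
  -- The cocycle condition on the cone over `σ`, solved for the term of its base `σ`.
  have hδ : ∀ σ : SingularSimplex X n,
      φ.1 σ = -∑ i : Fin (n + 1), (-1) ^ ((i : ℕ) + 1) * φ.1 ((cone n σ).face i.succ) := fun σ => by
    have : ∑ i : Fin (n + 2), (-1) ^ (i : ℕ) * φ.1 ((cone n σ).face i) = 0 :=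
      congr(($(AddMonoidHom.mem_ker.1 hφ)).1 (cone n σ))
    rw [Fin.sum_univ_succ, face_zero] at this
    simp only [Fin.val_zero, pow_zero, one_mul, Fin.val_succ] at this
    linarith
  cases n with
  | zero =>
    -- In degree 0 the only other face of the cone is the apex `p`, which lies off `K` because the
    -- track of a point outside `L` ends there.
    refine AddSubgroup.mem_bot.2 (Subtype.ext (funext fun σ => ?_))
    obtain ⟨x, hx⟩ := hLX
    have hpK : p ∉ K := h0 x ▸ hLK x hx 0
    have hface : φ.1 ((cone 0 σ).face (Fin.succ 0)) = 0 := by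
      refine hφK _ (Set.disjoint_left.2 ?_)
      rintro _ ⟨w, rfl⟩
      have hw : stdSimplex.map (Fin.succAbove (Fin.succ 0)) w = stdSimplexCone 0 (w, 0) := by
        refine stdSimplex.ext (funext fun i => ?_)
        refine Fin.cases ?_ (fun j => ?_) i
        · rw [stdSimplexCone_zero]
          conv_lhs => rw [← Fin.succ_succAbove_zero (0 : Fin 1)]
          rw [stdSimplex.map_apply_of_injective Fin.succAbove_right_injective]
          simp
        · rw [stdSimplexCone_succ, stdSimplex.map_apply_of_notMem_range]
          · simp
          · intro k
            fin_cases k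
            fin_cases j
            decide
      change cone 0 σ (stdSimplex.map (Fin.succAbove (Fin.succ 0)) w) ∉ K
      rwa [hw, hcone, h0]
    rw [hδ σ]
    rw [Fin.sum_univ_one, hface, mul_zero, neg_zero]
    rfl
  | succ n =>
    refine ⟨⟨fun σ => φ.1 (cone n σ), L, hL, fun σ hσ => hφK _ (Set.disjoint_left.2 ?_)⟩, ?_⟩
    · rintro _ ⟨w, rfl⟩
      obtain ⟨⟨u, s⟩, rfl⟩ := stdSimplexCone_surjective n w
      rw [hcone]
      exact hLK _ (Set.disjoint_left.1 hσ ⟨u, rfl⟩) s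
    · refine Subtype.ext (funext fun σ => ?_)
      rw [hδ σ, ← Finset.sum_neg_distrib]
      change ∑ i : Fin (n + 2), (-1) ^ (i : ℕ) * φ.1 (cone n (σ.face i)) = _
      refine Finset.sum_congr rfl fun i _ => ?_
      rw [face_succ]
      ring

/-! ### Limit rays and the conclusion -/

/-- In a proper space, if arbitrarily long geodesic segments from `p` meet the compact set `K`,
then so does some geodesic ray from `p`. -/
theorem exists_geodesicRay_of_segments {X : Type*} [MetricSpace X] [ProperSpace X] {p : X}
    {K : Set X} (hK : IsCompact K)
    (h : ∀ R : ℝ, ∃ x c, R < dist p x ∧ IsGeodesicSegment p x c ∧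
      ∃ t ∈ Set.Icc 0 (dist p x), c t ∈ K) :
    ∃ α : ℝ → X, IsGeodesicRay α ∧ α 0 = p ∧ ∃ t ∈ Set.Ici (0 : ℝ), α t ∈ K := by
  choose x c hx hc t ht htK using fun n : ℕ => h n
  -- Limits along one ultrafilter, for all parameters at once, replace a diagonal argument.
  let U : Filter ℕ := Filter.hyperfilter ℕ
  have hU : ∀ s : ℝ, ∀ᶠ n in U, s ≤ dist p (x n) := fun s => by
    filter_upwards [Nat.hyperfilter_le_atTop (Filter.eventually_ge_atTop ⌈s⌉₊)] with n hn
    exact (Nat.ceil_le.1 hn).trans (hx n).le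
  have hlim : ∀ s : ℝ, ∃ y, 0 ≤ s → Filter.Tendsto (fun n => c n s) U (nhds y) := fun s => by
    by_cases hs : 0 ≤ s
    · obtain ⟨y, -, hy⟩ := (isCompact_closedBall p s).ultrafilter_le_nhds'
        ((Filter.hyperfilter ℕ).map fun n => c n s) (by
          change ∀ᶠ n in U, c n s ∈ Metric.closedBall p s
          filter_upwards [hU s] with n hn
          rw [Metric.mem_closedBall, ← (hc n).source,
            (hc n).isometry s ⟨hs, hn⟩ 0 ⟨le_rfl, dist_nonneg⟩, sub_zero, abs_of_nonneg hs])
      exact ⟨y, fun _ => hy⟩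
    · exact ⟨p, fun h => absurd h hs⟩
  choose α hα using hlim
  -- The segments have unit speed, so they meet `K` at bounded times, which converge to some `r`.
  obtain ⟨M, hM⟩ := hK.isBounded.subset_closedBall p
  have htM : ∀ n, t n ∈ Set.Icc 0 M := fun n => by
    refine ⟨(ht n).1, ?_⟩
    have := hM (htK n)
    rwa [Metric.mem_closedBall, ← (hc n).source,
      (hc n).isometry _ (ht n) 0 ⟨le_rfl, dist_nonneg⟩, sub_zero, abs_of_nonneg (ht n).1] at this
  obtain ⟨r, hr, htr⟩ := (isCompact_Icc (a := (0 : ℝ)) (b := M)).ultrafilter_le_nhds'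
    ((Filter.hyperfilter ℕ).map t)
    (show ∀ᶠ n in U, t n ∈ Set.Icc 0 M from Filter.Eventually.of_forall htM)
  replace htr : Filter.Tendsto t U (nhds r) := htr
  refine ⟨α, fun s hs s' hs' => ?_, ?_, r, hr.1, ?_⟩
  · refine tendsto_nhds_unique ((hα s hs).dist (hα s' hs')) (tendsto_const_nhds.congr' ?_)
    filter_upwards [hU s, hU s'] with n hn hn'
    exact ((hc n).isometry s ⟨hs, hn⟩ s' ⟨hs', hn'⟩).symm
  · refine tendsto_nhds_unique (hα 0 le_rfl) (tendsto_const_nhds.congr' ?_)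
    exact Filter.Eventually.of_forall fun n => (hc n).source.symm
  · refine hK.isClosed.mem_of_tendsto (f := fun n => c n (t n)) (b := U) ?_
      (Filter.Eventually.of_forall htK)
    refine (hα r hr.1).congr_dist ?_
    have h0 : Filter.Tendsto (fun n => |r - t n|) U (nhds 0) := by
      simpa using ((tendsto_const_nhds (x := r)).sub htr).abs
    refine h0.congr' ?_
    filter_upwards [hU r] with n hn
    exact ((hc n).isometry r ⟨hr.1, hn⟩ _ (ht n)).symm

theorem CompactCohomology.exists_notMem_compactCoboundaries {X : Type*} [TopologicalSpace X]
    {n : ℕ} (h : Nontrivial (CompactCohomology X n)) :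
    ∃ φ ∈ compactCocycles X n, φ ∉ compactCoboundaries X n := by
  obtain ⟨y, hy⟩ := exists_ne (0 : CompactCohomology X n)
  obtain ⟨φ, rfl⟩ := QuotientAddGroup.mk_surjective y
  exact ⟨φ, φ.2, fun hφ => hy ((QuotientAddGroup.eq_zero_iff φ).2 hφ)⟩

/-- A nonzero class with compact supports is carried by a compact set which is met by geodesic
rays from every point. -/
theorem IsCAT0.exists_isCompact_forall_geodesicRay {X : Type*} [MetricSpace X] [ProperSpace X]
    [NoncompactSpace X] (hX : IsCAT0 X) {n : ℕ} (h : Nontrivial (CompactCohomology X n)) :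
    ∃ K : Set X, IsCompact K ∧ ∀ p : X, ∃ α : ℝ → X, IsGeodesicRay α ∧ α 0 = p ∧
      ∃ t ∈ Set.Ici (0 : ℝ), α t ∈ K := by
  obtain ⟨φ, hφ, hφ'⟩ := CompactCohomology.exists_notMem_compactCoboundaries h
  obtain ⟨K, hK, hφK⟩ := φ.2
  refine ⟨K, hK, fun p => exists_geodesicRay_of_segments hK ?_⟩
  by_contra! ⟨R, hR⟩
  obtain ⟨c, H, hc, hH⟩ := hX.exists_geodesic_contraction p
  refine hφ' (mem_compactCoboundaries_of_contraction (p := p) H (fun x => ?_) (fun x => ?_)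
    (isCompact_closedBall p R) ?_ (fun x hx t => ?_) hφ hφK)
  · simp [hH, (hc x).source]
  · simp [hH, (hc x).target]
  · by_contra! hall
    exact noncompact_univ X ((isCompact_closedBall p R).of_isClosed_subset isClosed_univ
      fun x _ => hall x)
  · rw [hH]
    rw [Metric.mem_closedBall, not_le, dist_comm] at hx
    exact hR x (c x) hx (hc x) _
      ⟨mul_nonneg t.2.1 dist_nonneg, mul_le_of_le_one_left dist_nonneg t.2.2⟩

theorem theoremA {X Γ : Type*} [MetricSpace X] [ProperSpace X] [NoncompactSpace X]
    (hX : IsCAT0 X) [Group Γ] [MulAction Γ X] [IsIsometricSMul Γ X]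
    (hΓ : IsCocompactAction Γ X)
    (hH : ∃ i : ℕ, Nontrivial (CompactCohomology X i)) :
    IsAlmostGeodesicallyComplete X := by
  obtain ⟨i, hi⟩ := hH
  obtain ⟨K, hK, hray⟩ := hX.exists_isCompact_forall_geodesicRay hi
  obtain ⟨C, hC, hcov⟩ := hΓ
  -- `M` bounds the distance from any point of `C` to any point of `K`.
  obtain ⟨M, hM⟩ := Metric.isBounded_iff.1 (hC.union hK).isBounded
  refine ⟨hX.geodesic, M, fun p q => ?_⟩
  obtain ⟨γ, x, hx, rfl⟩ : ∃ γ : Γ, ∃ x ∈ C, γ • x = q := by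
    have hq : q ∈ ⋃ γ : Γ, (fun x : X => γ • x) '' C := hcov ▸ Set.mem_univ q
    simpa using hq
  -- The translate by `γ` of this ray starts at `p` and meets `γK`, within `M` of `q ∈ γC`.
  obtain ⟨α, hα, hα0, t, ht, htK⟩ := hray (γ⁻¹ • p)
  refine ⟨fun s => γ • α s, fun s hs s' hs' => ?_, ?_, ?_⟩
  · rw [dist_smul, hα s hs s' hs']
  · simp [hα0]
  · refine (Metric.infDist_le_dist_of_mem (Set.mem_image_of_mem _ ht)).trans ?_
    rw [dist_smul]
    exact hM (Or.inl hx) (Or.inr htK)
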